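/- **Corollary (diagonal linear nets, kernel regime).** Let $n\ge 1$ and let $(x_1,y_1),\dots,(x_n,y_n)\in\mathbb{R}^d\times\{-1,+1\}$ be linearly separable training data, i.e. there is $w\in\mathbb{R}^d$ with $y_i\langle w,x_i\rangle>0$ for all $i$ (in particular this holds if $y_i=\operatorname{sign}\langle w^*,x_i\rangle\in\{\pm1\}$ for a ground-truth vector $w^*$). For $\theta=(u,v)\in\mathbb{R}^d\times\mathbb{R}^d\simeq\mathbb{R}^{2d}$ consider the two-layer diagonal linear net $$f(\theta;x)=\sum_{k=1}^d u_k^2x_k-\sum_{k=1}^d v_k^2x_k=\langle w(\theta),x\rangle,\qquad w(\theta):=u^{\odot 2}-v^{\odot 2},$$ and the exponential training loss with weight decay $\lambda>0$, $$\mathcal{L}_\lambda(\theta)=\frac1n\sum_{i=1}^n e^{-y_if(\theta;x_i)}+\frac{\lambda}{2}\|\theta\|_2^2 .$$ Let the weight decay $\lambda=\lambda(\alpha)>0$ depend on the initialization scale $\alpha>0$, with $\lambda(\alpha)=\Theta(\alpha^{-p})$ as $\alpha\to+\infty$ for some constant $p>0$. For each $\alpha>0$ let $\theta(t;\alpha\bar\theta_{\mathrm{init}})$,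 $t\ge 0$, be the solution of the gradient flow $\frac{d\theta}{dt}=-\nabla\mathcal{L}_{\lambda(\alpha)}(\theta)$ started at $\theta(0)=\alpha\bar\theta_{\mathrm{init}}$, $\bar\theta_{\mathrm{init}}=(\mathbf 1,\mathbf 1)$ (such a solution exists on all of $[0,\infty)$). Then the margin $\min_{i}y_i\langle w,x_i\rangle$ has a unique maximizer $w_2^*$ over the unit sphere $\{w\in\mathbb{R}^d:\|w\|_2=1\}$, and for every constant $c\in(0,1)$, with $T_c^-(\alpha):=\frac{1-c}{\lambda(\alpha)}\log\alpha$, $$\lim_{\alpha\to+\infty}\frac{w\big(\theta(T_c^-(\alpha);\alpha\bar\theta_{\mathrm{init}})\big)}{\big\|w\big(\theta(T_c^-(\alpha);\alpha\bar\theta_{\mathrm{init}})\big)\big\|_2}=w_2^*=\operatorname*{arg\,max}_{\|w\|_2=1}\ \min_{1\le i\le n}y_i\langle w,x_i\rangle .$$ -/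

import Mathlib

namespace DiagNet

noncomputable section

/-- Parameters `θ = (u, v) ∈ ℝ^d × ℝ^d ≃ ℝ^{2d}` with the Euclidean norm:
`u k = θ (Sum.inl k)` and `v k = θ (Sum.inr k)`. -/
abbrev Param (d : ℕ) : Type := EuclideanSpace ℝ (Fin d ⊕ Fin d)

/-- The two-layer diagonal linear net `f(θ; x) = ∑ k, u_k² x_k - ∑ k, v_k² x_k`. -/
def net {d : ℕ} (θ : Param d) (x : EuclideanSpace ℝ (Fin d)) : ℝ :=
  ∑ k, θ (Sum.inl k) ^ 2 * x k - ∑ k, θ (Sum.inr k) ^ 2 * x k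

/-- The effective weight `w(θ) = u^{⊙2} - v^{⊙2}`. -/
def effectiveWeight {d : ℕ} (θ : Param d) : EuclideanSpace ℝ (Fin d) :=
  WithLp.toLp 2 fun k => θ (Sum.inl k) ^ 2 - θ (Sum.inr k) ^ 2

/-- The initial direction `(1, 1)`: every coordinate of `u` and of `v` equals one. -/
def initDirection (d : ℕ) : Param d := WithLp.toLp 2 fun _ => 1

/-- The exponential loss `ℓ(ŷ; y) = exp (- y ŷ)`. -/
def expLoss (yhat y : ℝ) : ℝ := Real.exp (-(y * yhat))

/-- The training loss `L(θ) = (1/n) ∑ i, ℓ(f(θ; x_i); y_i)`. -/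
def trainLoss {d n : ℕ} (x : Fin n → EuclideanSpace ℝ (Fin d)) (y : Fin n → ℝ)
    (θ : Param d) : ℝ :=
  (1 / (n : ℝ)) * ∑ i, expLoss (net θ (x i)) (y i)

/-- The training loss with weight decay, `L_lam(θ) = L(θ) + (lam/2) ‖θ‖²`. -/
def regLoss {d n : ℕ} (x : Fin n → EuclideanSpace ℝ (Fin d)) (y : Fin n → ℝ)
    (lam : ℝ) (θ : Param d) : ℝ :=
  trainLoss x y θ + lam / 2 * ‖θ‖ ^ 2

/-- `θ` is a trajectory on `[0, ∞)` of the gradient flow `dθ/dt = -∇F(θ)` with `θ(0) = θ₀`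
(the derivative at `t = 0` is one-sided). -/
def IsGradientFlow {E : Type*} [NormedAddCommGroup E] [InnerProductSpace ℝ E] [CompleteSpace E]
    (F : E → ℝ) (θ₀ : E) (θ : ℝ → E) : Prop :=
  θ 0 = θ₀ ∧
    ∀ t : ℝ, 0 ≤ t → HasDerivWithinAt θ (-(gradient F (θ t))) (Set.Ici 0) t

/-- The margin `min_i y_i ⟪w, x_i⟫` of the linear classifier `w` on the data
(used for `n ≥ 1` only). -/
def margin {d n : ℕ} (x : Fin n → EuclideanSpace ℝ (Fin d)) (y : Fin n → ℝ)
    (w : EuclideanSpace ℝ (Fin d)) : ℝ :=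
  ⨅ i, y i * inner ℝ w (x i)

/-- `argmax_{w ∈ S^{d-1}} min_i y_i ⟪w, x_i⟫`, as the set of all maximizers. -/
def maxL2MarginDirections {d n : ℕ} (x : Fin n → EuclideanSpace ℝ (Fin d)) (y : Fin n → ℝ) :
    Set (EuclideanSpace ℝ (Fin d)) :=
  {w | w ∈ Metric.sphere (0 : EuclideanSpace ℝ (Fin d)) 1 ∧
    IsMaxOn (margin x y) (Metric.sphere (0 : EuclideanSpace ℝ (Fin d)) 1) w}

end

end DiagNet

/-! Along the flow, `u` and `v` solve scalar linear equations with opposite data forces. With `G`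
the time integral of the force and `β = α² exp (-2 lam t)`, this gives `w = 2β sinh (4G)`
coordinatewise. The vector `ω = 8βG` obeys the kernel dynamics `ω' = 8β g(w) - 2 lam ω`, where `g`
is the negative loss gradient, and `‖w - ω‖ ≤ ‖ω‖² / (2β)`. Up to time `T = (1 - c) / lam * log α`,
`β` stays at least `α ^ (2c)` while `‖ω‖` is only `O(log α)`, so `w` and `ω` stay close.

Write `β = lam exp M` with `M = M₀ - 2 lam t`. The factor `exp M` turns each loss weight into `exp
(-(margin - M))`, so the data force pushes up margins below `M` while weight decay shrinks `ω`.
Hence `ω` follows `M • v`, with `v` the shortest vector of margin at least one. A differential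
inequality for `‖ω - M • v‖²` (`IsHardMarginVector.drift_le`, `IsHardMarginVector.norm_sub_sq_le`)
shows that the initial error decays like `exp (-lam t)`, which is `α ^ (-(1 - c))` at time `T`, up
to an arbitrarily small multiple of `M₀²`. As `M(T) ≥ c M₀ → ∞`, the direction of `w` tends to that
of `v`, the unique maximizer of the margin. -/

section

open Set Filter Topology NNReal

/-! ### Global existence for ordinary differential equations -/

/-- A compactly supported `C¹` vector field has forward trajectories for all times. -/
theorem exists_forall_hasDerivWithinAt_Ici_of_hasCompactSupport {E : Type*}
    [NormedAddCommGroup E] [NormedSpace ℝ E] [CompleteSpace E] {V : E → E}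
    (hV : ContDiff ℝ 1 V) (hc : HasCompactSupport V) (x₀ : E) :
    ∃ θ : ℝ → E, θ 0 = x₀ ∧ ∀ t : ℝ, 0 ≤ t → HasDerivWithinAt θ (V (θ t)) (Ici 0) t := by
  obtain ⟨K, hK⟩ := hV.lipschitzWith_of_hasCompactSupport hc one_ne_zero
  obtain ⟨C, hC⟩ := hc.exists_bound_of_continuous hV.continuous
  have hsol : ∀ N : ℕ, ∃ θ : ℝ → E, θ 0 = x₀ ∧
      ∀ t ∈ Icc (0 : ℝ) (N + 1), HasDerivWithinAt θ (V (θ t)) (Icc 0 (N + 1)) t := by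
    intro N
    have h0 : (0 : ℝ) ∈ Icc (0 : ℝ) (N + 1) := ⟨le_rfl, by positivity⟩
    -- The field is bounded by `C` everywhere, so a ball of radius `C * (N + 1)` contains the
    -- trajectory up to time `N + 1`.
    have hp : IsPicardLindelof (fun _ => V) (⟨0, h0⟩ : Icc (0 : ℝ) (N + 1)) x₀
        (C.toNNReal * (N + 1)) 0 C.toNNReal K := by
      refine IsPicardLindelof.of_time_independent
        (fun x _ => (hC x).trans (Real.le_coe_toNNReal C)) hK.lipschitzOnWith ?_
      have : (0 : ℝ) ≤ N + 1 := by positivity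
      simp [max_eq_left this]
    exact hp.exists_eq_forall_mem_Icc_hasDerivWithinAt₀
  choose α hα0 hα using hsol
  have hmono : ∀ N M : ℕ, N ≤ M → EqOn (α N) (α M) (Icc (0 : ℝ) (N + 1)) := by
    intro N M hNM
    have hNM' : (N : ℝ) + 1 ≤ M + 1 := by gcongr
    have key : ∀ M : ℕ, N ≤ M → ContinuousOn (α M) (Icc (0 : ℝ) (N + 1)) ∧
        ∀ t ∈ Ico (0 : ℝ) (N + 1), HasDerivWithinAt (α M) (V (α M t)) (Ici t) t := by
      intro M hNM
      have hNM' : (N : ℝ) + 1 ≤ M + 1 := by gcongr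
      refine ⟨fun t ht => ((hα M t ⟨ht.1, ht.2.trans hNM'⟩).continuousWithinAt).mono
        (Icc_subset_Icc_right hNM'), fun t ht => ?_⟩
      refine (hα M t ⟨ht.1, (ht.2.trans_le hNM').le⟩).mono_of_mem_nhdsWithin ?_
      exact mem_of_superset (Icc_mem_nhdsGE (ht.2.trans_le hNM'))
        (Icc_subset_Icc_left ht.1)
    exact ODE_solution_unique (v := fun _ => V) (fun _ => hK) (key N le_rfl).1 (key N le_rfl).2
      (key M hNM).1 (key M hNM).2 (by rw [hα0, hα0])
  -- The spare unit of time in each interval makes the glued function agree with a single solution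
  -- on a neighbourhood of `t` in `[0, ∞)`.
  have heq : ∀ (M : ℕ) (s : ℝ), 0 ≤ s → s ≤ M → α ⌈s⌉₊ s = α M s := fun M s h0 hs =>
    hmono _ _ (Nat.ceil_le.2 hs) ⟨h0, (Nat.le_ceil s).trans (by linarith)⟩
  refine ⟨fun s => α ⌈s⌉₊ s, by simpa using hα0 _, fun t ht => ?_⟩
  have htM : t < (⌈t⌉₊ + 1 : ℕ) := by
    push_cast
    linarith [Nat.le_ceil t]
  have hd := hα (⌈t⌉₊ + 1) t ⟨ht, by linarith⟩
  have hmem : Icc (0 : ℝ) ((⌈t⌉₊ + 1 : ℕ) + 1) ∈ 𝓝[Ici 0] t := by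
    rw [← Ici_inter_Iic]
    exact inter_mem self_mem_nhdsWithin
      (mem_nhdsWithin_of_mem_nhds (Iic_mem_nhds (by linarith)))
  have hd' := hd.mono_of_mem_nhdsWithin hmem
  simp only [heq _ t ht htM.le]
  refine hd'.congr_of_eventuallyEq ?_ (heq _ t ht htM.le)
  filter_upwards [self_mem_nhdsWithin, mem_nhdsWithin_of_mem_nhds (Iic_mem_nhds htM)]
    with s hs hs'
  exact heq _ s hs hs'

/-- A `C¹` vector field pointing strictly inwards on a sphere has forward trajectories for all
times from every point of the ball. -/
theorem exists_forall_hasDerivWithinAt_Ici_of_inner_neg {E : Type*}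
    [NormedAddCommGroup E] [InnerProductSpace ℝ E] [FiniteDimensional ℝ E] {V : E → E}
    (hV : ContDiff ℝ 1 V) {R : ℝ} (hR : 0 < R)
    (hin : ∀ x : E, ‖x‖ ^ 2 = R ^ 2 → inner ℝ x (V x) < 0) (x₀ : E) (hx₀ : ‖x₀‖ ≤ R) :
    ∃ θ : ℝ → E, θ 0 = x₀ ∧ ∀ t : ℝ, 0 ≤ t → HasDerivWithinAt θ (V (θ t)) (Ici 0) t := by
  have : CompleteSpace E := FiniteDimensional.complete ℝ E
  let φ : ContDiffBump (0 : E) := ⟨R, R + 1, hR, by linarith⟩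
  have hφ : ∀ x : E, ‖x‖ ≤ R → φ x = 1 := fun x hx =>
    φ.one_of_mem_closedBall (by simpa using hx)
  obtain ⟨θ, h0, hθ⟩ := exists_forall_hasDerivWithinAt_Ici_of_hasCompactSupport
    (V := fun x => φ x • V x) (φ.contDiff.smul hV) (φ.hasCompactSupport.smul_right) x₀
  have hcont : ContinuousOn θ (Ici 0) := fun t ht => (hθ t ht).continuousWithinAt
  have hball : ∀ t : ℝ, 0 ≤ t → ‖θ t‖ ≤ R := by
    intro t ht
    -- The cut-off equals one on the closed ball, so the inward condition keeps the truncated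
    -- trajectory there, where it solves the original equation.
    have hle := image_le_of_deriv_right_lt_deriv_boundary (a := 0) (b := t)
      (f := fun s => ‖θ s‖ ^ 2) (B := fun _ => R ^ 2) (B' := fun _ => 0)
      (f' := fun s => 2 * inner ℝ (θ s) (φ (θ s) • V (θ s)))
      ((hcont.mono Icc_subset_Ici_self).norm.pow 2)
      (fun s hs => ((hθ s hs.1).mono (Ici_subset_Ici.2 hs.1)).norm_sq)
      (by simpa [h0] using pow_le_pow_left₀ (norm_nonneg _) hx₀ 2)
      (fun s => hasDerivAt_const s _) (fun s hs h => by
        have hs' : ‖θ s‖ ≤ R := (abs_le_of_sq_le_sq' h.le hR.le).2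
        rw [hφ _ hs', one_smul]
        linarith [hin _ h]) (right_mem_Icc.2 ht)
    exact (abs_le_of_sq_le_sq' hle hR.le).2
  refine ⟨θ, h0, fun t ht => ?_⟩
  simpa [hφ _ (hball t ht)] using hθ t ht

/-! ### The gradient field of the regularized loss -/

namespace DiagNet

/-- The negative gradient at `w` of the exponential loss `(1/n) ∑ i, exp (-⟪w, z i⟫)` of the
linear predictor `w` on the margin vectors `z`. -/
noncomputable def expForce {E : Type*} [NormedAddCommGroup E] [InnerProductSpace ℝ E] {n : ℕ}
    (z : Fin n → E) (w : E) : E :=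
  (1 / (n : ℝ)) • ∑ i, Real.exp (-inner ℝ w (z i)) • z i

variable {d n : ℕ} (x : Fin n → EuclideanSpace ℝ (Fin d)) (y : Fin n → ℝ)

/-- The force exerted by the labelled data `(x, y)` on the effective weight. -/
noncomputable def dataForce (θ : Param d) : EuclideanSpace ℝ (Fin d) :=
  expForce (fun i => y i • x i) (effectiveWeight θ)

/-- The negative gradient of the regularized training loss of the diagonal net. -/
noncomputable def flowField (lam : ℝ) (θ : Param d) : Param d :=
  WithLp.toLp 2 (Sum.elim
    (fun k => (2 * dataForce x y θ k - lam) * θ (Sum.inl k))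
    (fun k => (-(2 * dataForce x y θ k) - lam) * θ (Sum.inr k)))

theorem net_eq_inner (θ : Param d) (v : EuclideanSpace ℝ (Fin d)) :
    net θ v = inner ℝ (effectiveWeight θ) v := by
  simp only [net, effectiveWeight, PiLp.inner_apply, ← Finset.sum_sub_distrib]
  exact Finset.sum_congr rfl fun k _ => by simp; ring

theorem dataForce_apply (θ : Param d) (k : Fin d) :
    dataForce x y θ k
      = (1 / (n : ℝ)) * ∑ i, Real.exp (-(y i * net θ (x i))) * (y i * x i k) := by
  simp [dataForce, expForce, inner_smul_right, net_eq_inner]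

theorem hasFDerivAt_net (θ : Param d) (v : EuclideanSpace ℝ (Fin d)) :
    HasFDerivAt (fun θ : Param d => net θ v)
      (∑ k, (2 * θ (Sum.inl k) * v k) • (EuclideanSpace.proj (𝕜 := ℝ) (Sum.inl k : Fin d ⊕ Fin d) :
          Param d →L[ℝ] ℝ)
        - ∑ k, (2 * θ (Sum.inr k) * v k) •
          (EuclideanSpace.proj (𝕜 := ℝ) (Sum.inr k : Fin d ⊕ Fin d) : Param d →L[ℝ] ℝ)) θ := by
  have hproj : ∀ j : Fin d ⊕ Fin d, HasFDerivAt (fun θ : Param d => θ j)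
      (EuclideanSpace.proj (𝕜 := ℝ) j : Param d →L[ℝ] ℝ) θ := fun j =>
    (EuclideanSpace.proj (𝕜 := ℝ) j : Param d →L[ℝ] ℝ).hasFDerivAt
  refine (HasFDerivAt.fun_sum fun k _ => ?_).sub (HasFDerivAt.fun_sum fun k _ => ?_)
  · refine (((hproj (Sum.inl k)).pow 2).mul_const (v k)).congr_fderiv ?_
    ext h
    simp
    ring
  · refine (((hproj (Sum.inr k)).pow 2).mul_const (v k)).congr_fderiv ?_
    ext h
    simp
    ring

theorem hasGradientAt_regLoss (lam : ℝ) (θ : Param d) :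
    HasGradientAt (regLoss x y lam) (-flowField x y lam θ) θ := by
  rw [hasGradientAt_iff_hasFDerivAt]
  have h1 : HasFDerivAt (trainLoss x y) _ θ :=
    (HasFDerivAt.fun_sum (u := Finset.univ) fun (i : Fin n) _ =>
      (((hasFDerivAt_net θ (x i)).const_mul (y i)).fun_neg).exp).const_mul (1 / (n : ℝ))
  have h2 : HasFDerivAt (fun θ : Param d => lam / 2 * ‖θ‖ ^ 2) _ θ :=
    ((hasStrictFDerivAt_norm_sq θ).hasFDerivAt).const_mul (lam / 2)
  refine (h1.add h2).congr_fderiv ?_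
  ext h
  have hswap : ∀ (c : Fin n → ℝ) (u v : Fin d → ℝ),
      ∑ i, c i * ∑ k, 2 * u k * x i k * v k = ∑ k, v k * ((2 * ∑ i, c i * x i k) * u k) := by
    intro c u v
    simp only [Finset.mul_sum, Finset.sum_mul]
    rw [Finset.sum_comm]
    exact Finset.sum_congr rfl fun k _ => Finset.sum_congr rfl fun i _ => by ring
  have e1 := hswap (fun i => 1 / (n : ℝ) * (Real.exp (-(y i * net θ (x i))) * y i))
    (fun k => θ (Sum.inl k)) (fun k => h (Sum.inl k))
  have e2 := hswap (fun i => 1 / (n : ℝ) * (Real.exp (-(y i * net θ (x i))) * y i))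
    (fun k => θ (Sum.inr k)) (fun k => h (Sum.inr k))
  have hg : ∀ k, dataForce x y θ k
      = ∑ i, 1 / (n : ℝ) * (Real.exp (-(y i * net θ (x i))) * y i) * x i k := by
    intro k
    rw [dataForce_apply, Finset.mul_sum]
    exact Finset.sum_congr rfl fun i _ => by ring
  simp only [← hg] at e1 e2
  have e3 : (1 / (n : ℝ)) * ∑ i, Real.exp (-(y i * net θ (x i))) *
      -(y i * (∑ k, 2 * θ (Sum.inl k) * x i k * h (Sum.inl k)
        - ∑ k, 2 * θ (Sum.inr k) * x i k * h (Sum.inr k)))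
      = -(∑ k, h (Sum.inl k) * (2 * dataForce x y θ k * θ (Sum.inl k)))
        + ∑ k, h (Sum.inr k) * (2 * dataForce x y θ k * θ (Sum.inr k)) := by
    rw [← e1, ← e2, Finset.mul_sum, ← Finset.sum_neg_distrib, ← Finset.sum_add_distrib]
    exact Finset.sum_congr rfl fun i _ => by ring
  have hproj : ∀ j : Fin d ⊕ Fin d, (EuclideanSpace.proj (𝕜 := ℝ) j : Param d →L[ℝ] ℝ) h = h j :=
    fun _ => rfl
  simp only [flowField, InnerProductSpace.toDual_apply_apply, PiLp.inner_apply,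
    Fintype.sum_sum_type, add_apply, smul_apply,
    sum_apply, neg_apply, sub_apply,
    smul_eq_mul, innerSL_apply_apply, hproj, e3]
  simp only [nsmul_eq_mul, PiLp.neg_apply, Sum.elim_inl, Sum.elim_inr, RCLike.inner_apply, conj_trivial,
    Finset.mul_sum, ← Finset.sum_neg_distrib, ← Finset.sum_add_distrib, mul_add]
  exact Finset.sum_congr rfl fun k _ => by push_cast; ring

theorem contDiff_flowField (lam : ℝ) : ContDiff ℝ 1 (flowField x y lam) := by
  have hproj : ∀ j : Fin d ⊕ Fin d, ContDiff ℝ 1 (fun θ : Param d => θ j) := fun j =>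
    (EuclideanSpace.proj (𝕜 := ℝ) j : Param d →L[ℝ] ℝ).contDiff
  have hnet : ∀ v : EuclideanSpace ℝ (Fin d), ContDiff ℝ 1 (fun θ : Param d => net θ v) := by
    intro v
    unfold net
    exact (ContDiff.sum fun k _ => ((hproj (Sum.inl k)).pow 2).mul contDiff_const).sub
      (ContDiff.sum fun k _ => ((hproj (Sum.inr k)).pow 2).mul contDiff_const)
  have hg : ∀ k, ContDiff ℝ 1 (fun θ : Param d => dataForce x y θ k) := by
    intro k
    simp only [dataForce_apply]
    exact contDiff_const.mul (ContDiff.sum fun i _ =>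
      ((contDiff_const.mul (hnet _)).neg.exp).mul contDiff_const)
  rw [contDiff_euclidean]
  rintro (k | k)
  · exact ((contDiff_const.mul (hg k)).sub contDiff_const).mul (hproj _)
  · exact ((contDiff_const.mul (hg k)).neg.sub contDiff_const).mul (hproj _)

/-- Each margin `q` contributes `q * exp (-q) ≤ 1`. This bounds the radial growth caused by the
data, so weight decay wins far from the origin. -/
theorem inner_expForce_le_one {E : Type*} [NormedAddCommGroup E] [InnerProductSpace ℝ E]
    (z : Fin n → E) (w : E) : inner ℝ w (expForce z w) ≤ 1 := by
  simp only [expForce, inner_smul_right, inner_sum]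
  have h : ∀ q : ℝ, Real.exp (-q) * q ≤ 1 := fun q => by
    have h1 := Real.add_one_le_exp q
    have h2 : Real.exp (-q) * Real.exp q = 1 := by rw [← Real.exp_add]; simp
    nlinarith [Real.exp_pos (-q)]
  calc (1 / (n : ℝ)) * ∑ i, Real.exp (-inner ℝ w (z i)) * inner ℝ w (z i)
      ≤ (1 / (n : ℝ)) * ∑ _i : Fin n, (1 : ℝ) := by
        gcongr
        exact h _
    _ ≤ 1 := by
        simpa using inv_mul_le_one

theorem inner_flowField (lam : ℝ) (θ : Param d) :
    inner ℝ θ (flowField x y lam θ)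
      = 2 * inner ℝ (effectiveWeight θ) (dataForce x y θ) - lam * ‖θ‖ ^ 2 := by
  rw [← real_inner_self_eq_norm_sq]
  simp only [flowField, effectiveWeight, PiLp.inner_apply, Fintype.sum_sum_type, Sum.elim_inl,
    Sum.elim_inr, RCLike.inner_apply, conj_trivial, mul_add, Finset.mul_sum,
    ← Finset.sum_add_distrib, ← Finset.sum_sub_distrib]
  exact Finset.sum_congr rfl fun k _ => by ring

theorem exists_isGradientFlow_regLoss {lam : ℝ} (hlam : 0 < lam) (θ₀ : Param d) :
    ∃ θ : ℝ → Param d, IsGradientFlow (regLoss x y lam) θ₀ θ := by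
  -- On the sphere with this squared radius the radial component is at most `2 - lam * ‖θ₀‖ ^ 2 - 3
  -- < 0`.
  have hpos : 0 < ‖θ₀‖ ^ 2 + 3 / lam := by positivity
  have hsq : Real.sqrt (‖θ₀‖ ^ 2 + 3 / lam) ^ 2 = ‖θ₀‖ ^ 2 + 3 / lam := Real.sq_sqrt hpos.le
  obtain ⟨θ, h0, hθ⟩ := exists_forall_hasDerivWithinAt_Ici_of_inner_neg
    (contDiff_flowField x y lam) (Real.sqrt_pos.2 hpos) (fun v hv => by
      rw [inner_flowField, hv, hsq, mul_add, mul_div_cancel₀ _ hlam.ne']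
      have h1 : inner ℝ (effectiveWeight v) (dataForce x y v) ≤ 1 := inner_expForce_le_one _ _
      nlinarith [mul_nonneg hlam.le (sq_nonneg ‖θ₀‖)]) θ₀
    (Real.le_sqrt_of_sq_le (by linarith [div_pos three_pos hlam]))
  refine ⟨θ, h0, fun t ht => ?_⟩
  rw [(hasGradientAt_regLoss x y lam (θ t)).gradient, neg_neg]
  exact hθ t ht

end DiagNet

/-! ### The hard-margin vector and the maximal margin -/

namespace DiagNet

/-- `v` is the hard-margin vector of the margin vectors `z`: it has margin at least one on each of
them, and every `w` with margin at least `m` satisfies `m ‖v‖² ≤ ⟪w, v⟫`. -/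
structure IsHardMarginVector {E : Type*} [NormedAddCommGroup E] [InnerProductSpace ℝ E] {n : ℕ}
    (z : Fin n → E) (v : E) : Prop where
  one_le_inner : ∀ i, 1 ≤ inner ℝ v (z i)
  mul_norm_sq_le : ∀ (w : E) (m : ℝ), (∀ i, m ≤ inner ℝ w (z i)) → m * ‖v‖ ^ 2 ≤ inner ℝ w v

/-- The vector is the projection of the origin onto the closed convex set of predictors with all
margins at least one; the second property is the variational inequality of the projection, extended
to all `m` by scaling and translation along `v`. -/
theorem exists_isHardMarginVector {E : Type*} [NormedAddCommGroup E] [InnerProductSpace ℝ E]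
    [CompleteSpace E] {n : ℕ} (z : Fin n → E) (hsep : ∃ w : E, ∀ i, 0 < inner ℝ w (z i)) :
    ∃ v, IsHardMarginVector z v := by
  let K : Set E := {w | ∀ i, 1 ≤ inner ℝ w (z i)}
  have hne : K.Nonempty := by
    obtain ⟨w, hw⟩ := hsep
    refine ⟨(∑ i, (inner ℝ w (z i))⁻¹) • w, fun j => ?_⟩
    rw [real_inner_smul_left, Finset.sum_mul]
    calc (1 : ℝ) = (inner ℝ w (z j))⁻¹ * inner ℝ w (z j) := (inv_mul_cancel₀ (hw j).ne').symm
      _ ≤ _ := Finset.single_le_sum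
          (f := fun i => (inner ℝ w (z i))⁻¹ * inner ℝ w (z j))
          (fun i _ => mul_nonneg (inv_nonneg.2 (hw i).le) (hw j).le) (Finset.mem_univ j)
  have hclosed : IsClosed K := by
    simp only [K, ofPred_forall]
    exact isClosed_iInter fun i => isClosed_le continuous_const (by fun_prop)
  have hconv : Convex ℝ K := by
    intro a ha b hb s t hs ht hst i
    rw [inner_add_left, real_inner_smul_left, real_inner_smul_left]
    nlinarith [mul_le_mul_of_nonneg_left (ha i) hs, mul_le_mul_of_nonneg_left (hb i) ht]
  obtain ⟨v, hvK, hv⟩ := exists_norm_eq_iInf_of_complete_convex hne hclosed.isComplete hconv 0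
  have hvar := (norm_eq_iInf_iff_real_inner_le_zero hconv hvK).1 hv
  have hK : ∀ w ∈ K, ‖v‖ ^ 2 ≤ inner ℝ w v := by
    intro w hw
    have h := hvar w hw
    rw [zero_sub, inner_neg_left, inner_sub_right, real_inner_self_eq_norm_sq,
      real_inner_comm] at h
    linarith
  refine ⟨v, hvK, fun w m hm => ?_⟩
  -- Adding `(1 + |m|) • v` makes the margin bound positive, so that rescaling lands in `K`; the
  -- added terms cancel at the end.
  have hs : 0 < 1 + |m| := by positivity
  have hms : 0 < m + (1 + |m|) := by linarith [neg_abs_le m]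
  have h := hK ((m + (1 + |m|))⁻¹ • (w + (1 + |m|) • v)) fun i => by
    rw [real_inner_smul_left, inner_add_left, real_inner_smul_left, ← div_eq_inv_mul, le_div_iff₀ hms,
      one_mul]
    nlinarith [hm i, hvK i]
  rw [real_inner_smul_left, inner_add_left, real_inner_smul_left, real_inner_self_eq_norm_sq,
    ← div_eq_inv_mul, le_div_iff₀ hms] at h
  linarith

variable {d n : ℕ} {x : Fin n → EuclideanSpace ℝ (Fin d)} {y : Fin n → ℝ}

theorem IsHardMarginVector.ne_zero {E : Type*} [NormedAddCommGroup E] [InnerProductSpace ℝ E]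
    {z : Fin n → E} {v : E} (hv : IsHardMarginVector z v) (hn : 1 ≤ n) : v ≠ 0 := by
  rintro rfl
  simpa using (hv.one_le_inner ⟨0, hn⟩).trans_lt' zero_lt_one

/-- Cauchy–Schwarz bounds the margin of a unit vector by `‖v‖⁻¹`, and its equality case forces the
direction of `v`. -/
theorem IsHardMarginVector.maxL2MarginDirections_eq {v : EuclideanSpace ℝ (Fin d)}
    (hv : IsHardMarginVector (fun i => y i • x i) v) (hn : 1 ≤ n) :
    maxL2MarginDirections x y = {‖v‖⁻¹ • v} := by
  have : Nonempty (Fin n) := ⟨⟨0, hn⟩⟩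
  have hvpos : 0 < ‖v‖ := norm_pos_iff.2 (hv.ne_zero hn)
  have hunit : ‖‖v‖⁻¹ • v‖ = 1 := norm_smul_inv_norm (hv.ne_zero hn)
  have hupper : ∀ w : EuclideanSpace ℝ (Fin d), margin x y w * ‖v‖ ^ 2 ≤ inner ℝ w v := fun w =>
    hv.mul_norm_sq_le w _ fun i => by
      rw [real_inner_smul_right]
      exact ciInf_le (Set.finite_range _).bddBelow i
  have hlower : ‖v‖⁻¹ ≤ margin x y (‖v‖⁻¹ • v) := by
    refine le_ciInf fun i => ?_
    have h := hv.one_le_inner i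
    rw [real_inner_smul_right] at h
    rw [real_inner_smul_left]
    have := mul_le_mul_of_nonneg_left h (inv_nonneg.2 hvpos.le)
    linarith
  have hbound : ∀ w : EuclideanSpace ℝ (Fin d), ‖w‖ = 1 → margin x y w ≤ ‖v‖⁻¹ := by
    intro w hw
    have h := (hupper w).trans (real_inner_le_norm w v)
    rw [hw, one_mul, pow_two, ← mul_assoc] at h
    rw [← one_div, le_div_iff₀ hvpos]
    exact le_of_mul_le_mul_right (by linarith) hvpos
  ext w
  simp only [maxL2MarginDirections, mem_ofPred_eq, mem_sphere_zero_iff_norm, mem_singleton_iff]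
  constructor
  · rintro ⟨hw, hmax⟩
    have hm : ‖v‖⁻¹ ≤ margin x y w :=
      hlower.trans (hmax (mem_sphere_zero_iff_norm.2 hunit))
    have h1 : ‖v‖ ≤ inner ℝ w v := by
      refine le_trans ?_ (hupper w)
      calc ‖v‖ = ‖v‖⁻¹ * ‖v‖ ^ 2 := by field_simp
        _ ≤ _ := by gcongr
    have h2 : inner ℝ w v = ‖w‖ * ‖v‖ :=
      le_antisymm (real_inner_le_norm w v) (by rwa [hw, one_mul])
    have h3 := inner_eq_norm_mul_iff_real.1 h2
    rw [hw, one_smul] at h3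
    rw [eq_inv_smul_iff₀ hvpos.ne', h3]
  · rintro rfl
    exact ⟨hunit, fun w hw =>
      (hbound w (mem_sphere_zero_iff_norm.1 hw)).trans hlower⟩

end DiagNet

/-! ### Tracking the hard-margin vector along the kernel dynamics -/

namespace DiagNet

variable {E : Type*} [NormedAddCommGroup E] [InnerProductSpace ℝ E] {n : ℕ} {z : Fin n → E} {v : E}

theorem exp_neg_mul_add_half_le_one (s : ℝ) : Real.exp (-s) * (s + 1 / 2) ≤ 1 := by
  have h1 := Real.add_one_le_exp s
  have h2 : Real.exp (-s) * Real.exp s = 1 := by rw [← Real.exp_add]; simp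
  nlinarith [Real.exp_pos (-s)]

/-- Here `s + 1 / 2 ≤ -1 / 2` and `exp (-s) ≥ (-s) ^ 3 / 6`. Cubic growth suffices to beat the
linear loss from a violated margin in `drift_le`. -/
theorem exp_neg_mul_add_half_le_of_le_neg_one {s : ℝ} (hs : s ≤ -1) :
    Real.exp (-s) * (s + 1 / 2) ≤ -((-s) ^ 3 / 12) := by
  have h1 := Real.pow_div_factorial_le_exp (x := -s) (by linarith) 3
  norm_num [Nat.factorial] at h1
  nlinarith [Real.exp_pos (-s)]

/-- The drift of a predictor `ω` relative to the multiple `M • v` of the hard-margin vector, when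
the loss is evaluated at a predictor `w` whose margins are close to those of `ω`. -/
theorem IsHardMarginVector.drift_le (hv : IsHardMarginVector z v) (hn : 1 ≤ n) {w ω : E} {M ε : ℝ}
    (hε : 0 < ε) (hM : 1 ≤ ε * M) (hM' : 3 * n * ‖v‖ ^ 2 ≤ ε ^ 2 * M)
    (hclose : ∀ i, |inner ℝ ω (z i) - inner ℝ w (z i)| ≤ 1 / 2) :
    8 * Real.exp M * inner ℝ (ω - M • v) (expForce z w) - 2 * M * inner ℝ (ω - M • v) v
      ≤ 8 + M * ‖v‖ ^ 2 + 2 * ε * ‖v‖ ^ 2 * M ^ 2 := by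
  have : Nonempty (Fin n) := ⟨⟨0, hn⟩⟩
  have hn0 : (0 : ℝ) < n := by exact_mod_cast hn
  have hMpos : 0 < M := pos_of_mul_pos_right (zero_lt_one.trans_le hM) hε.le
  obtain ⟨N, hN⟩ : ∃ N, N = ‖v‖ ^ 2 := ⟨_, rfl⟩
  have hN0 : 0 ≤ N := hN ▸ sq_nonneg _
  let s : Fin n → ℝ := fun i => inner ℝ w (z i) - M
  have hz : ∀ i, inner ℝ (ω - M • v) (z i) ≤ s i + 1 / 2 := by
    intro i
    rw [inner_sub_left, real_inner_smul_left]
    have h1 := (abs_le.1 (hclose i)).2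
    have h2 := mul_le_mul_of_nonneg_left (hv.one_le_inner i) hMpos.le
    simp only [s]
    linarith
  have hforce : Real.exp M * inner ℝ (ω - M • v) (expForce z w)
      ≤ (1 / (n : ℝ)) * ∑ i, Real.exp (-s i) * (s i + 1 / 2) := by
    simp only [expForce, real_inner_smul_right, inner_sum]
    rw [mul_left_comm, Finset.mul_sum]
    refine mul_le_mul_of_nonneg_left (Finset.sum_le_sum fun i _ => ?_) (by positivity)
    rw [← mul_assoc, ← Real.exp_add]
    have : M + -inner ℝ w (z i) = -s i := by simp only [s]; ring
    rw [this]
    gcongr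
    exact hz i
  obtain ⟨j, hj⟩ := Finite.exists_min s
  have hinner : (s j - 1 / 2) * N ≤ inner ℝ (ω - M • v) v := by
    have h := hv.mul_norm_sq_le ω (s j + M - 1 / 2) fun i => by
      have h1 := (abs_le.1 (hclose i)).1
      have h2 := hj i
      simp only [s] at h2 ⊢
      linarith
    rw [inner_sub_left, real_inner_smul_left, real_inner_self_eq_norm_sq, ← hN]
    rw [← hN] at h
    linarith
  have hMinner := mul_le_mul_of_nonneg_left hinner (by positivity : 0 ≤ 2 * M)
  rw [← hN] at hM' ⊢
  -- A worst margin defect of at most `ε * M` costs at most the `ε * M ^ 2` term. A larger defect is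
  -- paid for by the cubic gain of the single sample `j`.
  rcases le_or_gt (-s j) (ε * M) with hs | hs
  · have hsum : (1 / (n : ℝ)) * ∑ i, Real.exp (-s i) * (s i + 1 / 2) ≤ 1 := by
      calc (1 / (n : ℝ)) * ∑ i, Real.exp (-s i) * (s i + 1 / 2)
          ≤ (1 / (n : ℝ)) * ∑ _i : Fin n, (1 : ℝ) := by
            gcongr
            exact exp_neg_mul_add_half_le_one _
        _ = 1 := by simp [hn0.ne']
    have h1 := mul_le_mul_of_nonneg_left hs (by positivity : 0 ≤ 2 * M * N)
    nlinarith
  · have hsum : (1 / (n : ℝ)) * ∑ i, Real.exp (-s i) * (s i + 1 / 2)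
        ≤ 1 - (-s j) ^ 3 / (12 * n) := by
      have h1 : ∑ i, Real.exp (-s i) * (s i + 1 / 2) ≤ n - (-s j) ^ 3 / 12 := by
        rw [← Finset.add_sum_erase _ _ (Finset.mem_univ j)]
        have h2 : ∑ i ∈ Finset.univ.erase j, Real.exp (-s i) * (s i + 1 / 2) ≤ n := by
          calc ∑ i ∈ Finset.univ.erase j, Real.exp (-s i) * (s i + 1 / 2)
              ≤ ∑ _i ∈ Finset.univ.erase j, (1 : ℝ) :=
                Finset.sum_le_sum fun i _ => exp_neg_mul_add_half_le_one _
            _ ≤ ∑ _i : Fin n, (1 : ℝ) := Finset.sum_le_sum_of_subset_of_nonneg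
                (Finset.erase_subset _ _) fun _ _ _ => zero_le_one
            _ = n := by simp
        have h3 := exp_neg_mul_add_half_le_of_le_neg_one (s := s j) (by linarith)
        linarith
      calc (1 / (n : ℝ)) * ∑ i, Real.exp (-s i) * (s i + 1 / 2)
          ≤ (1 / (n : ℝ)) * (n - (-s j) ^ 3 / 12) := by gcongr
        _ = _ := by field_simp
    have ha : 0 < -s j := by linarith
    have hsq : 3 * n * (M * N) ≤ (-s j) ^ 2 := by
      calc 3 * n * (M * N) = M * (3 * n * N) := by ring
        _ ≤ M * (ε ^ 2 * M) := by gcongr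
        _ = (ε * M) ^ 2 := by ring
        _ ≤ (-s j) ^ 2 := by gcongr
    have hcube : 2 * (M * N) * (-s j) ≤ 8 * ((-s j) ^ 3 / (12 * n)) := by
      rw [mul_div_assoc', le_div_iff₀ (by positivity)]
      nlinarith [mul_le_mul_of_nonneg_right hsq ha.le]
    have hnn : 0 ≤ 2 * ε * N * M ^ 2 := by positivity
    nlinarith

/-- A trajectory of the linearized (kernel) dynamics tracks the multiple `(M₀ - 2 lam t) • v` of
the hard-margin vector, as long as the margins of the predictor `w` at which the loss is evaluated
stay close to those of `ω`. -/
theorem IsHardMarginVector.norm_sub_sq_le (hv : IsHardMarginVector z v) (hn : 1 ≤ n)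
    {w ω : ℝ → E} {lam M₀ T ε η : ℝ} (hlam : 0 < lam) (hT : 0 ≤ T) (hε : 0 < ε) (hη : 0 < η)
    (hM : 1 ≤ ε * (M₀ - 2 * lam * T)) (hM' : 3 * n * ‖v‖ ^ 2 ≤ ε ^ 2 * (M₀ - 2 * lam * T))
    (hE : 2 * (8 + M₀ * ‖v‖ ^ 2 + ‖v‖ ^ 2 + 2 * ε * ‖v‖ ^ 2 * M₀ ^ 2) < η * M₀ ^ 2)
    (h0 : ω 0 = 0)
    (hω : ∀ t, 0 ≤ t → HasDerivWithinAt ω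
      ((8 * (lam * Real.exp (M₀ - 2 * lam * t))) • expForce z (w t) - (2 * lam) • ω t) (Ici 0) t)
    (hclose : ∀ t ∈ Icc 0 T, ‖ω t‖ ^ 2 ≤ (4 * ‖v‖ ^ 2 + 2 * η) * M₀ ^ 2 →
      ∀ i, |inner ℝ (ω t) (z i) - inner ℝ (w t) (z i)| ≤ 1 / 2) :
    ‖ω T - (M₀ - 2 * lam * T) • v‖ ^ 2
        ≤ (‖v‖ ^ 2 * M₀ ^ 2) * Real.exp (-lam * T) + η * M₀ ^ 2 ∧
      ‖ω T‖ ^ 2 ≤ (4 * ‖v‖ ^ 2 + 2 * η) * M₀ ^ 2 := by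
  obtain ⟨N, hN⟩ : ∃ N, N = ‖v‖ ^ 2 := ⟨_, rfl⟩
  have hN0 : 0 ≤ N := hN ▸ sq_nonneg _
  have hMT : 0 < M₀ - 2 * lam * T := pos_of_mul_pos_right (zero_lt_one.trans_le hM) hε.le
  rw [← hN] at hM' hE hclose ⊢
  have hMt : ∀ t ∈ Icc 0 T, M₀ - 2 * lam * T ≤ M₀ - 2 * lam * t := fun t ht => by
    nlinarith [mul_le_mul_of_nonneg_left ht.2 hlam.le]
  have hMle : ∀ t ∈ Icc 0 T, M₀ - 2 * lam * t ≤ M₀ := fun t ht => by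
    nlinarith [mul_nonneg hlam.le ht.1]
  -- The tracking bound implies the size bound on `ω` that `hclose` requires, so closeness is
  -- available whenever the barrier is touched.
  have hsmall : ∀ t ∈ Icc 0 T, ‖ω t - (M₀ - 2 * lam * t) • v‖ ^ 2
      ≤ (N * M₀ ^ 2) * Real.exp (-lam * t) + η * M₀ ^ 2 →
      ‖ω t‖ ^ 2 ≤ (4 * N + 2 * η) * M₀ ^ 2 := by
    intro t ht hQ
    have h1 : ‖ω t‖ ≤ ‖ω t - (M₀ - 2 * lam * t) • v‖ + ‖(M₀ - 2 * lam * t) • v‖ :=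
      norm_le_norm_sub_add _ _
    have h2 : ‖(M₀ - 2 * lam * t) • v‖ ^ 2 ≤ M₀ ^ 2 * N := by
      rw [norm_smul, mul_pow, ← hN, Real.norm_eq_abs, sq_abs]
      gcongr
      · exact (hMT.trans_le (hMt t ht)).le
      · exact hMle t ht
    have h3 : Real.exp (-lam * t) ≤ 1 := Real.exp_le_one_iff.2 (by nlinarith [mul_nonneg hlam.le ht.1])
    have h4 := mul_le_mul_of_nonneg_left h3 (by positivity : 0 ≤ N * M₀ ^ 2)
    nlinarith [norm_nonneg (ω t), pow_le_pow_left₀ (norm_nonneg _) h1 2,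
      sq_nonneg (‖ω t - (M₀ - 2 * lam * t) • v‖ - ‖(M₀ - 2 * lam * t) • v‖)]
  have hderiv : ∀ t, 0 ≤ t → HasDerivWithinAt (fun t => ω t - (M₀ - 2 * lam * t) • v)
      (((8 * (lam * Real.exp (M₀ - 2 * lam * t))) • expForce z (w t) - (2 * lam) • ω t)
        - (-(2 * lam)) • v) (Ici 0) t := by
    intro t ht
    refine (hω t ht).sub (HasDerivWithinAt.smul_const ?_ v)
    simpa using ((hasDerivWithinAt_id t (Ici 0)).const_mul (2 * lam)).const_sub M₀
  -- The barrier starts above the initial squared distance `‖M₀ • v‖²`. At contact its derivative is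
  -- `-lam * (‖e‖ ^ 2 - η * M₀ ^ 2)` with `e = ω - M • v`, and `drift_le` with `hE` makes the
  -- derivative of `‖e‖ ^ 2` strictly smaller.
  have hle := image_le_of_deriv_right_lt_deriv_boundary (a := 0) (b := T)
    (f := fun t => ‖ω t - (M₀ - 2 * lam * t) • v‖ ^ 2)
    (B := fun t => (N * M₀ ^ 2) * Real.exp (-lam * t) + η * M₀ ^ 2)
    (B' := fun t => (N * M₀ ^ 2) * (Real.exp (-lam * t) * -lam))
    (fun t ht => (((hderiv t ht.1).norm_sq).continuousWithinAt).mono Icc_subset_Ici_self)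
    (fun t ht => ((hderiv t ht.1).norm_sq).mono (Ici_subset_Ici.2 ht.1))
    (by
      simp only [h0, zero_sub, norm_neg, norm_smul, mul_pow, ← hN, Real.norm_eq_abs, sq_abs]
      simp
      nlinarith [mul_nonneg hη.le (sq_nonneg M₀)])
    (fun t => by
      have h : HasDerivAt (fun t : ℝ => -lam * t) (-lam) t := by
        simpa using (hasDerivAt_id t).const_mul (-lam)
      exact (h.exp.const_mul _).add_const _)
    (fun t ht hB => by
      have htI := Ico_subset_Icc_self ht
      have hc := hclose t htI (hsmall t htI hB.le)
      have hMle' := hMle t htI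
      have hMt' := hMt t htI
      have hdrift := hv.drift_le (M := M₀ - 2 * lam * t) hn hε (hM.trans (by gcongr)) ((hN ▸ hM').trans (by gcongr)) hc
      have hB' : N * M₀ ^ 2 * Real.exp (-lam * t)
          = ‖ω t - (M₀ - 2 * lam * t) • v‖ ^ 2 - η * M₀ ^ 2 := by linarith
      rw [← mul_assoc (N * M₀ ^ 2), hB']
      rw [← hN] at hdrift
      generalize hMdef : M₀ - 2 * lam * t = M at *
      have hM0 : 0 < M := by linarith
      set e := ω t - M • v with he
      have hωe : ω t = e + M • v := by rw [he]; abel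
      rw [hωe, inner_sub_right, inner_sub_right, real_inner_smul_right, real_inner_smul_right,
        real_inner_smul_right, inner_add_right, real_inner_smul_right, real_inner_self_eq_norm_sq]
      have hev : 2 * inner ℝ e v ≤ ‖e‖ ^ 2 + N := by
        have h1 := real_inner_le_norm e v
        rw [hN]
        nlinarith [sq_nonneg (‖e‖ - ‖v‖)]
      have hMM : M * N + 2 * ε * N * M ^ 2 ≤ M₀ * N + 2 * ε * N * M₀ ^ 2 := by gcongr
      have hQ := sq_nonneg ‖e‖
      have hfin : 2 * (8 * Real.exp M * inner ℝ e (expForce z (w t)) - 2 * (‖e‖ ^ 2 + M * inner ℝ e v)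
          + 2 * inner ℝ e v) < -(‖e‖ ^ 2 - η * M₀ ^ 2) := by
        linarith
      nlinarith [mul_lt_mul_of_pos_left hfin hlam])
  have hfinal := hle (right_mem_Icc.2 hT)
  exact ⟨hfinal, hsmall T (right_mem_Icc.2 hT) hfinal⟩

end DiagNet

/-! ### From the diagonal net to the kernel dynamics -/

namespace DiagNet

theorem abs_sinh_sub_self_le {s : ℝ} (hs : |s| ≤ 1) : |Real.sinh s - s| ≤ s ^ 2 := by
  have h1 := abs_le.1 (Real.abs_exp_sub_one_sub_id_le hs)
  have h2 := abs_le.1 (Real.abs_exp_sub_one_sub_id_le (x := -s) (by rwa [abs_neg]))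
  rw [Real.sinh_eq, abs_le]
  constructor <;> nlinarith

/-- The map `ω ↦ 2β sinh (ω / 2β)` is quadratically close to the identity. -/
theorem norm_sub_le_of_eq_sinh {d : ℕ} {w ω : EuclideanSpace ℝ (Fin d)} {β : ℝ} (hβ : 0 < β)
    (hw : ∀ k, w k = 2 * β * Real.sinh (ω k / (2 * β))) (hω : ‖ω‖ ≤ 2 * β) :
    ‖w - ω‖ ≤ ‖ω‖ ^ 2 / (2 * β) := by
  have hcoord : ∀ k, |w k - ω k| ≤ ω k ^ 2 / (2 * β) := by
    intro k
    have h1 : |ω k / (2 * β)| ≤ 1 := by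
      rw [abs_div, abs_of_pos (by positivity : 0 < 2 * β), div_le_one (by positivity)]
      exact (PiLp.norm_apply_le ω k).trans hω
    have h2 : w k - ω k = 2 * β * (Real.sinh (ω k / (2 * β)) - ω k / (2 * β)) := by
      rw [hw, mul_sub, mul_div_cancel₀ _ (by positivity)]
    rw [h2, abs_mul, abs_of_pos (by positivity : 0 < 2 * β)]
    calc 2 * β * |Real.sinh (ω k / (2 * β)) - ω k / (2 * β)|
        ≤ 2 * β * (ω k / (2 * β)) ^ 2 := by gcongr; exact abs_sinh_sub_self_le h1
      _ = _ := by field_simp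
  refine abs_le_of_sq_le_sq' ?_ (by positivity) |>.2
  rw [EuclideanSpace.norm_sq_eq, EuclideanSpace.norm_sq_eq, div_pow]
  calc ∑ k, ‖(w - ω) k‖ ^ 2 ≤ ∑ k, (‖ω k‖ ^ 2) ^ 2 / (2 * β) ^ 2 := by
        refine Finset.sum_le_sum fun k _ => ?_
        have := pow_le_pow_left₀ (abs_nonneg _) (hcoord k) 2
        simpa [div_pow] using this
    _ = (∑ k, (‖ω k‖ ^ 2) ^ 2) / (2 * β) ^ 2 := by rw [Finset.sum_div]
    _ ≤ (∑ k, ‖ω k‖ ^ 2) ^ 2 / (2 * β) ^ 2 := by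
        gcongr
        exact Finset.sum_sq_le_sq_sum_of_nonneg fun _ _ => sq_nonneg _

/-- Solution formula for a scalar linear equation `u' = (a - lam) u`. -/
theorem eq_mul_exp_of_hasDerivWithinAt {u a A : ℝ → ℝ} {lam : ℝ} (hA0 : A 0 = 0)
    (hA : ∀ t, 0 ≤ t → HasDerivWithinAt A (a t) (Ici 0) t)
    (hu : ∀ t, 0 ≤ t → HasDerivWithinAt u ((a t - lam) * u t) (Ici 0) t) {t : ℝ} (ht : 0 ≤ t) :
    u t = u 0 * Real.exp (A t - lam * t) := by
  have hd : ∀ s, 0 ≤ s →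
      HasDerivWithinAt (fun s => u s * Real.exp (lam * s - A s)) 0 (Ici 0) s := by
    intro s hs
    have h1 : HasDerivWithinAt (fun s => lam * s - A s) (lam - a s) (Ici 0) s := by
      simpa using ((hasDerivWithinAt_id s (Ici 0)).const_mul lam).fun_sub (hA s hs)
    exact ((hu s hs).fun_mul h1.exp).congr_deriv (by ring)
  have hconst := constant_of_has_deriv_right_zero (a := 0) (b := t)
    (fun s hs => ((hd s hs.1).continuousWithinAt).mono Icc_subset_Ici_self)
    (fun s hs => (hd s hs.1).mono (Ici_subset_Ici.2 hs.1)) t (right_mem_Icc.2 ht)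
  simp only [hA0, mul_zero, sub_zero, Real.exp_zero, mul_one] at hconst
  rw [← hconst, mul_assoc, ← Real.exp_add]
  simp

/-- The effective weight of the gradient flow is, up to the map `ω ↦ 2β sinh (ω / 2β)` with
`β = α² exp (-2 lam t)`, a trajectory `ω` of the linearized (kernel) dynamics. -/
theorem IsGradientFlow.exists_kernel_trajectory {d n : ℕ} {x : Fin n → EuclideanSpace ℝ (Fin d)}
    {y : Fin n → ℝ} {lam α : ℝ} (hα : 0 < α) {θ : ℝ → Param d}
    (hθ : IsGradientFlow (regLoss x y lam) (α • initDirection d) θ) :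
    ∃ ω : ℝ → EuclideanSpace ℝ (Fin d), ω 0 = 0 ∧
      (∀ t, 0 ≤ t → HasDerivWithinAt ω ((8 * (α ^ 2 * Real.exp (-(2 * lam * t)))) •
        dataForce x y (θ t) - (2 * lam) • ω t) (Ici 0) t) ∧
      ∀ t, 0 ≤ t → ∀ k, effectiveWeight (θ t) k = 2 * (α ^ 2 * Real.exp (-(2 * lam * t))) *
        Real.sinh (ω t k / (2 * (α ^ 2 * Real.exp (-(2 * lam * t))))) := by
  obtain ⟨h0, hflow⟩ := hθ
  have hflow' : ∀ t, 0 ≤ t → HasDerivWithinAt θ (flowField x y lam (θ t)) (Ici 0) t := by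
    intro t ht
    have h := hflow t ht
    rwa [(hasGradientAt_regLoss x y lam (θ t)).gradient, neg_neg] at h
  have hcoord : ∀ (j : Fin d ⊕ Fin d) (t : ℝ), 0 ≤ t →
      HasDerivWithinAt (fun t => θ t j) (flowField x y lam (θ t) j) (Ici 0) t := fun j t ht =>
    (EuclideanSpace.proj (𝕜 := ℝ) j : Param d →L[ℝ] ℝ).hasFDerivAt.comp_hasDerivWithinAt t
      (hflow' t ht)
  -- Freezing the trajectory at negative times gives a continuous integrand on the whole line.
  have hθc : Continuous fun t => θ (max t 0) := by
    have h : ContinuousOn θ (Ici 0) := fun t ht => (hflow' t ht).continuousWithinAt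
    exact h.comp_continuous (by fun_prop) fun t => le_max_right t 0
  have hw : Continuous (effectiveWeight : Param d → EuclideanSpace ℝ (Fin d)) := by
    unfold effectiveWeight
    fun_prop
  have hgc : Continuous fun t => dataForce x y (θ (max t 0)) := by
    unfold dataForce expForce
    have := hw.comp hθc
    fun_prop
  obtain ⟨G, hG⟩ : ∃ G : ℝ → EuclideanSpace ℝ (Fin d),
      G = fun t => ∫ s in (0 : ℝ)..t, dataForce x y (θ (max s 0)) := ⟨_, rfl⟩
  have hG0 : G 0 = 0 := by simp [hG]
  have hGd : ∀ t, 0 ≤ t → HasDerivWithinAt G (dataForce x y (θ t)) (Ici 0) t := by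
    intro t ht
    have h := (hgc.integral_hasStrictDerivAt 0 t).hasDerivAt.hasDerivWithinAt (s := Ici 0)
    rw [max_eq_left ht] at h
    rwa [hG]
  have hGk : ∀ (k : Fin d) (t : ℝ), 0 ≤ t →
      HasDerivWithinAt (fun t => 2 * G t k) (2 * dataForce x y (θ t) k) (Ici 0) t := fun k t ht =>
    ((EuclideanSpace.proj (𝕜 := ℝ) k :
      EuclideanSpace ℝ (Fin d) →L[ℝ] ℝ).hasFDerivAt.comp_hasDerivWithinAt t (hGd t ht)).const_mul 2
  have hinit : ∀ j, θ 0 j = α := fun j => by simp [h0, initDirection]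
  have hu : ∀ t, 0 ≤ t → ∀ k, θ t (Sum.inl k) = α * Real.exp (2 * G t k - lam * t) :=
    fun t ht k => by
      rw [← hinit (Sum.inl k)]
      exact eq_mul_exp_of_hasDerivWithinAt (by simp [hG0]) (hGk k) (hcoord (Sum.inl k)) ht
  have hv : ∀ t, 0 ≤ t → ∀ k, θ t (Sum.inr k) = α * Real.exp (-(2 * G t k) - lam * t) :=
    fun t ht k => by
      rw [← hinit (Sum.inr k)]
      exact eq_mul_exp_of_hasDerivWithinAt (A := fun t => -(2 * G t k)) (by simp [hG0])
        (fun t ht => (hGk k t ht).neg) (hcoord (Sum.inr k)) ht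
  -- With `ω = 8βG`, the decay of `β` produces the term `-2 lam ω`, and `ω / (2β) = 4G` is the
  -- exponent in `u² - v²`.
  refine ⟨fun t => (8 * (α ^ 2 * Real.exp (-(2 * lam * t)))) • G t, by simp [hG0],
    fun t ht => ?_, fun t ht k => ?_⟩
  · have h1 : HasDerivWithinAt (fun t => -(2 * lam * t)) (-(2 * lam)) (Ici 0) t := by
      simpa using ((hasDerivWithinAt_id t (Ici 0)).const_mul (2 * lam)).fun_neg
    have h2 := ((h1.exp.const_mul (α ^ 2)).const_mul 8).smul (hGd t ht)
    refine h2.congr_deriv ?_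
    rw [sub_eq_add_neg, smul_smul, ← neg_smul]
    congr 2
    ring
  · have hβ : α ^ 2 * Real.exp (-(2 * lam * t)) ≠ 0 := by positivity
    have h1 : ((8 * (α ^ 2 * Real.exp (-(2 * lam * t)))) • G t) k
        / (2 * (α ^ 2 * Real.exp (-(2 * lam * t)))) = 4 * G t k := by
      rw [PiLp.smul_apply, smul_eq_mul]
      field_simp
      ring
    rw [h1, Real.sinh_eq]
    simp only [effectiveWeight, hu t ht, hv t ht, mul_pow, ← Real.exp_nat_mul]
    have e1 : ((2 : ℕ) : ℝ) * (2 * G t k - lam * t) = -(2 * lam * t) + 4 * G t k := by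
      push_cast; ring
    have e2 : ((2 : ℕ) : ℝ) * (-(2 * G t k) - lam * t) = -(2 * lam * t) + -(4 * G t k) := by
      push_cast; ring
    rw [e1, e2, Real.exp_add, Real.exp_add]
    ring

end DiagNet

/-! ### Asymptotics for large initialization -/

namespace DiagNet

variable {d n : ℕ} {x : Fin n → EuclideanSpace ℝ (Fin d)} {y : Fin n → ℝ}
  {v : EuclideanSpace ℝ (Fin d)}

/-- Distance at time `T` between the effective weight of the gradient flow and a multiple of the
hard-margin vector, for a large initialization scale `α`. -/
theorem IsGradientFlow.norm_effectiveWeight_sub_le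
    (hv : IsHardMarginVector (fun i => y i • x i) v) (hn : 1 ≤ n) {α lam M₀ T ε η Z : ℝ}
    {θ : ℝ → Param d} (hα : 0 < α)
    (hθ : IsGradientFlow (regLoss x y lam) (α • initDirection d) θ)
    (hlam : 0 < lam) (hT : 0 ≤ T) (hε : 0 < ε) (hη : 0 < η)
    (hZ : 0 ≤ Z) (hxZ : ∀ i, ‖y i • x i‖ ≤ Z) (hM₀ : α ^ 2 = lam * Real.exp M₀)
    (hM : 1 ≤ ε * (M₀ - 2 * lam * T)) (hM' : 3 * n * ‖v‖ ^ 2 ≤ ε ^ 2 * (M₀ - 2 * lam * T))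
    (hE : 2 * (8 + M₀ * ‖v‖ ^ 2 + ‖v‖ ^ 2 + 2 * ε * ‖v‖ ^ 2 * M₀ ^ 2) < η * M₀ ^ 2)
    (hβ : 1 ≤ α ^ 2 * Real.exp (-(2 * lam * T)))
    (hker : (Z + 1) * ((4 * ‖v‖ ^ 2 + 2 * η) * M₀ ^ 2) ≤ α ^ 2 * Real.exp (-(2 * lam * T))) :
    ‖effectiveWeight (θ T) - (M₀ - 2 * lam * T) • v‖
      ≤ 1 + Real.sqrt ((‖v‖ ^ 2 * M₀ ^ 2) * Real.exp (-lam * T) + η * M₀ ^ 2) := by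
  obtain ⟨ω, h0, hω, hw⟩ := hθ.exists_kernel_trajectory hα
  have hrate : ∀ t, α ^ 2 * Real.exp (-(2 * lam * t)) = lam * Real.exp (M₀ - 2 * lam * t) :=
    fun t => by rw [hM₀, mul_assoc, ← Real.exp_add, ← sub_eq_add_neg]
  have hS0 : 0 ≤ (4 * ‖v‖ ^ 2 + 2 * η) * M₀ ^ 2 := by positivity
  have hclose : ∀ t ∈ Icc 0 T, ‖ω t‖ ^ 2 ≤ (4 * ‖v‖ ^ 2 + 2 * η) * M₀ ^ 2 →
      (Z + 1) * ‖effectiveWeight (θ t) - ω t‖ ≤ 1 / 2 := by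
    intro t ht hS
    have hβt : α ^ 2 * Real.exp (-(2 * lam * T)) ≤ α ^ 2 * Real.exp (-(2 * lam * t)) := by
      have := ht.2
      gcongr
    set β := α ^ 2 * Real.exp (-(2 * lam * t)) with hβdef
    have hβ1 : 1 ≤ β := hβ.trans hβt
    have hSβ : (Z + 1) * ‖ω t‖ ^ 2 ≤ β :=
      (mul_le_mul_of_nonneg_left hS (by positivity)).trans (hker.trans hβt)
    have hωβ : ‖ω t‖ ^ 2 ≤ β := by nlinarith [mul_nonneg hZ (sq_nonneg ‖ω t‖)]
    have hnorm : ‖ω t‖ ≤ 2 * β :=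
      (abs_le_of_sq_le_sq' (by nlinarith) (by positivity)).2
    have h := norm_sub_le_of_eq_sinh (by positivity) (hw t ht.1) hnorm
    calc (Z + 1) * ‖effectiveWeight (θ t) - ω t‖ ≤ (Z + 1) * (‖ω t‖ ^ 2 / (2 * β)) := by gcongr
      _ = ((Z + 1) * ‖ω t‖ ^ 2) / (2 * β) := by ring
      _ ≤ β / (2 * β) := by gcongr
      _ = 1 / 2 := by field_simp
  obtain ⟨hfin, hsmall⟩ := hv.norm_sub_sq_le hn (w := fun t => effectiveWeight (θ t)) hlam hT hε hη
    hM hM' hE h0 (fun t ht => by rw [← hrate]; exact hω t ht) (fun t ht hS i => by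
      rw [← inner_sub_left]
      refine (abs_real_inner_le_norm _ _).trans (le_trans ?_ (hclose t ht hS))
      rw [norm_sub_rev, mul_comm]
      gcongr
      linarith [hxZ i])
  have h1 : ‖effectiveWeight (θ T) - ω T‖ ≤ 1 := by
    have := hclose T (right_mem_Icc.2 hT) hsmall
    nlinarith [mul_nonneg hZ (norm_nonneg (effectiveWeight (θ T) - ω T))]
  calc ‖effectiveWeight (θ T) - (M₀ - 2 * lam * T) • v‖
      ≤ ‖effectiveWeight (θ T) - ω T‖ + ‖ω T - (M₀ - 2 * lam * T) • v‖ :=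
        norm_sub_le_norm_sub_add_norm_sub _ _ _
    _ ≤ _ := add_le_add h1 (Real.le_sqrt_of_sq_le hfin)

/-- The choice of `ε` makes the quadratic term on the left `η / 2 * m ^ 2`; the other half of the
budget absorbs the lower-order terms. -/
theorem eventually_kernel_regime {N c η ε : ℝ} (hN : 0 < N) (hc : 0 < c) (hη : 0 < η)
    (hε : ε = η / (8 * N)) (A B : ℝ) :
    ∀ᶠ m : ℝ in atTop, 1 ≤ ε * (c * m) ∧ A ≤ ε ^ 2 * (c * m) ∧
      2 * (8 + m * N + N + 2 * ε * N * m ^ 2) < η * m ^ 2 ∧ B < m := by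
  have hε0 : 0 < ε := by rw [hε]; positivity
  have t1 : Tendsto (fun m : ℝ => ε * (c * m)) atTop atTop :=
    (tendsto_id.const_mul_atTop hc).const_mul_atTop hε0
  have t2 : Tendsto (fun m : ℝ => ε ^ 2 * (c * m)) atTop atTop :=
    (tendsto_id.const_mul_atTop hc).const_mul_atTop (by positivity)
  filter_upwards [t1.eventually_ge_atTop 1, t2.eventually_ge_atTop A, eventually_gt_atTop B,
    eventually_ge_atTop 1, eventually_gt_atTop ((16 + 4 * N) / (η / 2))] with m h1 h2 h3 h4 h5
  refine ⟨h1, h2, ?_, h3⟩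
  have e1 : ε * N = η / 8 := by rw [hε]; field_simp
  rw [div_lt_iff₀ (by positivity)] at h5
  have h6 := mul_lt_mul_of_pos_right h5 (by linarith : 0 < m)
  have h7 : 2 * (8 + m * N + N + 2 * ε * N * m ^ 2)
      = 16 + 2 * m * N + 2 * N + η / 2 * m ^ 2 := by
    linear_combination 4 * m ^ 2 * e1
  rw [h7]
  nlinarith

theorem eventually_mul_sq_le_exp {A b : ℝ} (hA : 0 < A) (hb : 0 < b) :
    ∀ᶠ l : ℝ in atTop, A * l ^ 2 ≤ Real.exp (b * l) := by
  have h := (isLittleO_pow_exp_pos_mul_atTop 2 hb).bound (c := A⁻¹) (by positivity)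
  filter_upwards [h] with l hl
  rwa [Real.norm_of_nonneg (by positivity), Real.norm_of_nonneg (by positivity),
    ← div_eq_inv_mul, le_div_iff₀' hA] at hl

theorem eventually_mul_exp_neg_le (N : ℝ) {b η : ℝ} (hb : 0 < b) (hη : 0 < η) :
    ∀ᶠ l : ℝ in atTop, N * Real.exp (-(b * l)) ≤ η := by
  have h : Tendsto (fun l : ℝ => N * Real.exp (-(b * l))) atTop (𝓝 (N * 0)) :=
    (Real.tendsto_exp_neg_atTop_nhds_zero.comp (tendsto_id.const_mul_atTop hb)).const_mul _
  rw [mul_zero] at h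
  exact h.eventually_le_const hη

set_option maxHeartbeats 1000000 in
/-- In the kernel regime, the effective weight at time `(1 - c) / lam α * log α` is asymptotic to
`(2 c log α - log (lam α)) • v`, with `v` the hard-margin vector. -/
theorem tendsto_inv_smul_effectiveWeight
    (hv : IsHardMarginVector (fun i => y i • x i) v) (hn : 1 ≤ n) {p : ℝ} (hp : 0 < p)
    {lam : ℝ → ℝ} (hlam_pos : ∀ α : ℝ, 0 < α → 0 < lam α)
    (hlam : lam =Θ[atTop] fun α : ℝ => α ^ (-p)) {c : ℝ} (hc : c ∈ Ioo (0 : ℝ) 1)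
    {θ : ℝ → ℝ → Param d} (hθ : ∀ α : ℝ, 0 < α →
      IsGradientFlow (regLoss x y (lam α)) (α • initDirection d) (θ α)) :
    (∀ᶠ α in atTop, 0 < 2 * c * Real.log α - Real.log (lam α)) ∧
    Tendsto (fun α : ℝ => (2 * c * Real.log α - Real.log (lam α))⁻¹ •
      effectiveWeight (θ α ((1 - c) / lam α * Real.log α))) atTop (𝓝 v) := by
  obtain ⟨hc0, hc1⟩ := hc
  have hvpos : 0 < ‖v‖ := norm_pos_iff.2 (hv.ne_zero hn)
  have hlog : Tendsto Real.log atTop atTop := Real.tendsto_log_atTop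
  have hlam1 : ∀ᶠ α in atTop, lam α ≤ 1 := by
    have h : Tendsto lam atTop (𝓝 0) :=
      hlam.1.trans_tendsto (tendsto_rpow_neg_atTop hp)
    exact h.eventually_le_const zero_lt_one
  -- The lower half of the `Θ` bound gives `M₀ ≤ (p + 3) * log α`, so the power `α ^ (2c)` dominates
  -- `M₀ ^ 2`.
  have hlamlog : ∀ᶠ α in atTop, -Real.log (lam α) ≤ (p + 1) * Real.log α := by
    obtain ⟨C, hC, hbound⟩ := hlam.2.exists_pos
    filter_upwards [hbound.bound, eventually_gt_atTop 0,
      hlog.eventually_ge_atTop (Real.log C)] with α h hα hlC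
    have hl := hlam_pos α hα
    rw [Real.norm_of_nonneg (by positivity), Real.norm_of_nonneg hl.le] at h
    have h2 := Real.log_le_log (by positivity) h
    rw [Real.log_rpow hα, Real.log_mul hC.ne' hl.ne'] at h2
    linarith
  let M₀ : ℝ → ℝ := fun α => 2 * Real.log α - Real.log (lam α)
  have hM₀lim : Tendsto M₀ atTop atTop := by
    refine tendsto_atTop_mono' _ ?_ hlog
    filter_upwards [hlam1, eventually_gt_atTop 1] with α h1 hα
    have := Real.log_nonpos (hlam_pos α (by linarith)).le h1
    have := Real.log_pos hα
    simp only [M₀]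
    linarith
  have hMT : ∀ᶠ α in atTop, c * M₀ α ≤ 2 * c * Real.log α - Real.log (lam α) := by
    filter_upwards [hlam1, eventually_gt_atTop 0] with α h1 hα
    have := Real.log_nonpos (hlam_pos α hα).le h1
    simp only [M₀]
    nlinarith
  have hpos : ∀ᶠ α in atTop, 0 < 2 * c * Real.log α - Real.log (lam α) := by
    filter_upwards [hMT, hM₀lim.eventually_gt_atTop 0] with α h1 h2
    exact (mul_pos hc0 h2).trans_le h1
  refine ⟨hpos, ?_⟩
  obtain ⟨Z, hZ, hxZ⟩ : ∃ Z : ℝ, 0 ≤ Z ∧ ∀ i, ‖y i • x i‖ ≤ Z :=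
    ⟨∑ i, ‖y i • x i‖, Finset.sum_nonneg fun _ _ => norm_nonneg _, fun i => Finset.single_le_sum
      (f := fun i => ‖y i • x i‖) (fun _ _ => norm_nonneg _) (Finset.mem_univ i)⟩
  rw [Metric.tendsto_nhds]
  intro δ hδ
  -- `η` controls the tracking error, `ε` the margin defect
  obtain ⟨η, hηdef⟩ : ∃ η, η = (c * δ / 4) ^ 2 := ⟨_, rfl⟩
  have hη : 0 < η := by rw [hηdef]; positivity
  obtain ⟨ε, hεdef⟩ : ∃ ε, ε = η / (8 * ‖v‖ ^ 2) := ⟨_, rfl⟩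
  have hε : 0 < ε := by rw [hεdef]; positivity
  have hlarge := eventually_kernel_regime (N := ‖v‖ ^ 2) (by positivity) hc0 hη hεdef
    (3 * n * ‖v‖ ^ 2) (4 / (c * δ))
  have hker := eventually_mul_sq_le_exp (A := (Z + 1) * (4 * ‖v‖ ^ 2 + 2 * η) * (p + 3) ^ 2)
    (by positivity) (by positivity : 0 < 2 * c)
  have hdecay := eventually_mul_exp_neg_le (‖v‖ ^ 2) (by linarith : 0 < 1 - c) hη
  filter_upwards [hM₀lim.eventually hlarge, hlog.eventually hker, hlog.eventually hdecay, hMT, hpos,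
    hlamlog, hM₀lim.eventually_gt_atTop 0, eventually_gt_atTop 1]
    with α hlarge hker hdecay hMT hpos hlamlog hM₀pos hα1
  have hα : 0 < α := by linarith
  have hl := hlam_pos α hα
  have hlogα := Real.log_pos hα1
  have hlT : lam α * ((1 - c) / lam α * Real.log α) = (1 - c) * Real.log α := by field_simp
  obtain ⟨T, hTdef⟩ : ∃ T, T = (1 - c) / lam α * Real.log α := ⟨_, rfl⟩
  rw [← hTdef] at hlT ⊢
  have hT : 0 ≤ T := by
    rw [hTdef]
    exact mul_nonneg (div_nonneg (by linarith) hl.le) hlogα.le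
  have hMTeq : M₀ α - 2 * lam α * T = 2 * c * Real.log α - Real.log (lam α) := by
    simp only [M₀]
    linear_combination -2 * hlT
  have hM₀eq : α ^ 2 = lam α * Real.exp (M₀ α) := by
    simp only [M₀]
    rw [Real.exp_sub, Real.exp_log hl, mul_comm 2, Real.exp_mul, Real.exp_log hα]
    field_simp
    norm_cast
  have hβ : α ^ 2 * Real.exp (-(2 * lam α * T)) = Real.exp (2 * c * Real.log α) := by
    rw [← Real.exp_log (by positivity : 0 < α ^ 2), ← Real.exp_add, Real.log_pow]
    congr 1
    push_cast
    linear_combination -2 * hlT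
  obtain ⟨hl1, hl2, hl3, hl4⟩ := hlarge
  rw [← hMTeq] at hMT hpos ⊢
  have hmain := (hθ α hα).norm_effectiveWeight_sub_le hv hn hα hl hT hε hη hZ hxZ hM₀eq
    (hl1.trans (by gcongr)) (hl2.trans (by gcongr)) hl3
    (hβ ▸ Real.one_le_exp (by positivity)) (by
      rw [hβ]
      have hM₀le : M₀ α ≤ (p + 3) * Real.log α := by simp only [M₀]; linarith
      calc (Z + 1) * ((4 * ‖v‖ ^ 2 + 2 * η) * M₀ α ^ 2)
          ≤ (Z + 1) * ((4 * ‖v‖ ^ 2 + 2 * η) * ((p + 3) * Real.log α) ^ 2) := by gcongr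
        _ = (Z + 1) * (4 * ‖v‖ ^ 2 + 2 * η) * (p + 3) ^ 2 * Real.log α ^ 2 := by ring
        _ ≤ _ := hker)
  have hsqrt : Real.sqrt ((‖v‖ ^ 2 * M₀ α ^ 2) * Real.exp (-lam α * T) + η * M₀ α ^ 2)
      ≤ Real.sqrt 2 * (c * δ / 4) * M₀ α := by
    rw [Real.sqrt_le_left (by positivity), mul_pow, mul_pow, Real.sq_sqrt zero_le_two, ← hηdef,
      neg_mul, hlT]
    nlinarith [mul_le_mul_of_nonneg_right hdecay (sq_nonneg (M₀ α))]
  rw [dist_eq_norm]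
  have heq : (M₀ α - 2 * lam α * T)⁻¹ • effectiveWeight (θ α T) - v
      = (M₀ α - 2 * lam α * T)⁻¹ • (effectiveWeight (θ α T) - (M₀ α - 2 * lam α * T) • v) := by
    rw [smul_sub, smul_smul, inv_mul_cancel₀ hpos.ne', one_smul]
  rw [heq, norm_smul, norm_inv, Real.norm_of_nonneg hpos.le, ← div_eq_inv_mul, div_lt_iff₀ hpos]
  -- With `a = c * δ * M₀ / 4`, the additive error `1` is below `a` and the square root is at most
  -- `2 * a`; their sum is below `4 * a = δ * (c * M₀)`, and `c * M₀ ≤ M₀ - 2 * lam * T`.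
  rw [div_lt_iff₀ (by positivity)] at hl4
  have hs2 : Real.sqrt 2 ≤ 2 := Real.sqrt_le_left (by norm_num) |>.2 (by norm_num)
  have hcM : 0 ≤ c * δ / 4 * M₀ α := by positivity
  have h3 := mul_le_mul_of_nonneg_right hs2 hcM
  have h4 := mul_le_mul_of_nonneg_left hMT hδ.le
  nlinarith

end DiagNet

end

theorem mainTheorem8 {d n : ℕ} (hn : 1 ≤ n)
    (x : Fin n → EuclideanSpace ℝ (Fin d)) (y : Fin n → ℝ)
    (hy : ∀ i, y i = 1 ∨ y i = -1)
    (hsep : ∃ w : EuclideanSpace ℝ (Fin d), ∀ i, 0 < y i * inner ℝ w (x i))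
    (p : ℝ) (hp : 0 < p) (lam : ℝ → ℝ) (hlam_pos : ∀ α : ℝ, 0 < α → 0 < lam α)
    (hlam : lam =Θ[Filter.atTop] fun α : ℝ => α ^ (-p))
    (c : ℝ) (hc : c ∈ Set.Ioo (0 : ℝ) 1) :
    ∃ w₂ : EuclideanSpace ℝ (Fin d),
      DiagNet.maxL2MarginDirections x y = {w₂} ∧
      (∀ α : ℝ, 0 < α → ∃ θ : ℝ → DiagNet.Param d,
        DiagNet.IsGradientFlow (DiagNet.regLoss x y (lam α)) (α • DiagNet.initDirection d) θ) ∧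
      ∀ θ : ℝ → ℝ → DiagNet.Param d,
        (∀ α : ℝ, 0 < α →
          DiagNet.IsGradientFlow (DiagNet.regLoss x y (lam α))
            (α • DiagNet.initDirection d) (θ α)) →
        Filter.Tendsto
          (fun α : ℝ =>
            ‖DiagNet.effectiveWeight (θ α ((1 - c) / lam α * Real.log α))‖⁻¹ •
              DiagNet.effectiveWeight (θ α ((1 - c) / lam α * Real.log α)))
          Filter.atTop (nhds w₂) := by
  obtain ⟨v, hv⟩ := DiagNet.exists_isHardMarginVector (fun i => y i • x i) (by
    simpa only [real_inner_smul_right] using hsep)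
  refine ⟨‖v‖⁻¹ • v, hv.maxL2MarginDirections_eq hn, fun α hα =>
    DiagNet.exists_isGradientFlow_regLoss x y (hlam_pos α hα) _, fun θ hθ => ?_⟩
  obtain ⟨hpos, hlim⟩ :=
    DiagNet.tendsto_inv_smul_effectiveWeight hv hn hp hlam_pos hlam hc hθ
  -- The rescaling factor is eventually positive, so it disappears on normalizing; `v ≠ 0` makes
  -- normalization continuous at the limit.
  have hlim' := (hlim.norm.inv₀ (norm_ne_zero_iff.2 (hv.ne_zero hn))).smul hlim
  refine hlim'.congr' ?_
  filter_upwards [hpos] with α hα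
  rw [norm_smul, norm_inv, Real.norm_of_nonneg hα.le, smul_smul, mul_inv, inv_inv,
    mul_right_comm, mul_inv_cancel₀ hα.ne', one_mul]
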